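/- Let $\Sigma$ be any non-empty alphabet. A string $u$ over $\Sigma$ is primitive if there are no string $x$ and integer $k\ge 2$ with $u=x^k$; a primitively rooted square is a string $uu$ with $u$ primitive. An occurrence of a primitively rooted square in a string $w$ is a pair consisting of a position of $w$ and a primitively rooted square that is a substring of $w$ starting at that position. For an integer $n\ge 1$, let $\mathit{psq}(n)$ be the maximum, over all strings $w$ of length $n$ over $\Sigma$, of the number of occurrences of primitively rooted squares in $w$. Then this maximum exists and $$\mathit{psq}(n)\le n\log_2 n .$$ -/

import Mathlib

namespace Squares

variable {α : Type*}

/-- The power `x ^ k` of a string: the concatenation of `k` copies of `x`. -/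
def power (x : List α) (k : ℕ) : List α := (List.replicate k x).flatten

/-- A string is primitive if it is not `x ^ k` for any string `x` and any integer `k ≥ 2`.
In particular the empty string is not primitive. -/
def IsPrimitive (w : List α) : Prop := ¬ ∃ (x : List α) (k : ℕ), 2 ≤ k ∧ w = power x k

/-- A primitively rooted square is a string `u u` whose root `u` is primitive. -/
def IsPrimitivelyRootedSquare (s : List α) : Prop := ∃ u : List α, IsPrimitive u ∧ s = u ++ u

/-- The string `v` occurs in `w` at position `i` (positions are counted from `0`). -/
def OccursAt (v w : List α) (i : ℕ) : Prop := ∃ x y : List α, w = x ++ v ++ y ∧ x.length = i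

/-- The occurrences of primitively rooted squares in `w`: all pairs of a position and a
primitively rooted square that occurs in `w` at this position. -/
def squareOccurrences (w : List α) : Set (ℕ × List α) :=
  {o | IsPrimitivelyRootedSquare o.2 ∧ OccursAt o.2 w o.1}

/-- A string has only finitely many occurrences of squares, so counting them is meaningful. -/
theorem squareOccurrences_finite (w : List α) : (squareOccurrences w).Finite := by
  have hf : ((Set.Iic w.length ×ˢ Set.Iic w.length).image
      (fun p : ℕ × ℕ => (p.1, (w.drop p.1).take p.2))).Finite :=
    ((Set.finite_Iic _).prod (Set.finite_Iic _)).image _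
  refine hf.subset ?_
  rintro ⟨i, s⟩ ⟨-, x, y, h, hi⟩
  simp only at h hi
  subst hi
  subst h
  refine ⟨(x.length, s.length), ?_, ?_⟩
  · simp only [Set.mem_prod, Set.mem_Iic, List.length_append]
    omega
  · simp [List.append_assoc]

/-- The number of occurrences of primitively rooted squares in `w`. -/
noncomputable def numSquares (w : List α) : ℕ := (squareOccurrences w).ncard

/-- The numbers of occurrences of primitively rooted squares in the strings of length `n` over
the alphabet `α`. -/
def squareCounts (α : Type*) (n : ℕ) : Set ℕ :=
  {m | ∃ w : List α, w.length = n ∧ numSquares w = m}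

/-- `psq α n` is the maximum number of occurrences of primitively rooted squares in a string of
length `n` over the alphabet `α`. -/
noncomputable def psq (α : Type*) (n : ℕ) : ℕ := sSup (squareCounts α n)

end Squares

/-!
Every primitively rooted square of a string `w` of length `n` is charged to a ball of positions
around a local minimum of the suffix order of `w`, for one of two opposite lexicographic orders.

Let `u u` occur at `i`, with `u` primitive of length `p`, and follow the period `p` to the right
until it first fails, at `j`. In exactly one of the two orders, or in both if `j = n`, the letter
at `j` is smaller than the letter at `j - p`, the end of the string counting as the least letter.
In such an order let `a ∈ (i, i + p]` be the start of the least rotation of `u`. Then the suffix at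
`a` is smaller than all other suffixes starting in `(i, a + p)`, but larger than the suffix at
`a + p` (`exists_suffix_min`). Hence `p` is recovered from `a` as the distance to the next smaller
suffix, so that the square is determined by the order, `a`, and the radius `r = a - i ≤ p`, and the
suffix at `a` is the strict minimum on the ball `(a - r, a + r)`.

For any function on `[lo, hi]`, the number of such balls around strict minima is at most
`(m / 2) log₂ m` with `m = hi - lo` (`card_minBalls_le`): with `c` the place of an interior minimum,
a ball not centred at `c` lies on one side of `c`, and at most `min (c - lo) (hi - c)` balls are
centred at `c`; the recursion closes because the binary entropy is concave. The two orders together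
give `n log₂ n`.
-/

namespace Squares

/-! ### Balls around strict minima -/

open Classical in
/-- The pairs `(a, r)` with `r ≥ 1` such that the ball `(a - r, a + r)` lies within `[lo, hi]` and
`f` attains its strict minimum over the integers of this open interval at `a`. -/
noncomputable def minBalls {γ : Type*} [LinearOrder γ] (f : ℕ → γ) (lo hi : ℕ) : Finset (ℕ × ℕ) :=
  (Finset.range (hi + 1) ×ˢ Finset.range (hi + 1)).filter fun x =>
    0 < x.2 ∧ lo + x.2 ≤ x.1 ∧ x.1 + x.2 ≤ hi ∧
      ∀ k, x.1 < k + x.2 → k < x.1 + x.2 → k ≠ x.1 → f x.1 < f k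

theorem mem_minBalls {γ : Type*} [LinearOrder γ] {f : ℕ → γ} {lo hi a r : ℕ} :
    (a, r) ∈ minBalls f lo hi ↔ 0 < r ∧ lo + r ≤ a ∧ a + r ≤ hi ∧
      ∀ k, a < k + r → k < a + r → k ≠ a → f a < f k := by
  simp only [minBalls, Finset.mem_filter, Finset.mem_product, Finset.mem_range, and_iff_right_iff_imp]
  rintro ⟨_, _, _, _⟩
  omega

theorem two_mul_mul_log_two_le_binEntropy {t : ℝ} (h0 : 0 ≤ t) (h1 : t ≤ 1 / 2) :
    2 * t * Real.log 2 ≤ Real.binEntropy t := by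
  have h := Real.strictConcave_binEntropy.concaveOn.2 (show (0 : ℝ) ∈ Set.Icc 0 1 by simp)
    (show (2⁻¹ : ℝ) ∈ Set.Icc 0 1 by norm_num) (show 0 ≤ 1 - 2 * t by linarith)
    (show 0 ≤ 2 * t by linarith) (by ring)
  simp only [smul_eq_mul, mul_zero, zero_add, Real.binEntropy_zero, Real.binEntropy_two_inv] at h
  rwa [show 2 * t * 2⁻¹ = t by ring] at h

theorem mul_logb_add_mul_logb_add_le {x y : ℝ} (hx : 0 < x) (hxy : x ≤ y) :
    x / 2 * Real.logb 2 x + y / 2 * Real.logb 2 y + x ≤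
      (x + y) / 2 * Real.logb 2 (x + y) := by
  have hy : 0 < y := hx.trans_le hxy
  have hs : 0 < x + y := by positivity
  have h := two_mul_mul_log_two_le_binEntropy (t := x / (x + y)) (by positivity)
    (by rw [div_le_div_iff₀ hs two_pos]; linarith)
  have h2 : 0 < Real.log 2 := Real.log_pos one_lt_two
  rw [Real.binEntropy_eq_negMulLog_add_negMulLog_one_sub,
    show 1 - x / (x + y) = y / (x + y) by field_simp; ring,
    Real.negMulLog, Real.negMulLog, Real.log_div hx.ne' hs.ne', Real.log_div hy.ne' hs.ne'] at h
  have h' := mul_le_mul_of_nonneg_left h hs.le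
  have e1 : (x + y) * (2 * (x / (x + y)) * Real.log 2) = 2 * x * Real.log 2 := by field_simp
  have e2 : (x + y) * (-(x / (x + y)) * (Real.log x - Real.log (x + y)) +
      -(y / (x + y)) * (Real.log y - Real.log (x + y))) =
      (x + y) * Real.log (x + y) - x * Real.log x - y * Real.log y := by field_simp; ring
  rw [e1, e2] at h'
  simp only [Real.logb]
  rw [← sub_nonneg]
  have : (x + y) / 2 * (Real.log (x + y) / Real.log 2) -
      (x / 2 * (Real.log x / Real.log 2) + y / 2 * (Real.log y / Real.log 2) + x) =
      ((x + y) * Real.log (x + y) - x * Real.log x - y * Real.log y - 2 * x * Real.log 2) /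
        (2 * Real.log 2) := by field_simp; ring
  rw [this]
  exact div_nonneg (by linarith) (by positivity)

theorem mul_logb_add_mul_logb_add_min_le {x y : ℝ} (hx : 0 < x) (hy : 0 < y) :
    x / 2 * Real.logb 2 x + y / 2 * Real.logb 2 y + min x y ≤
      (x + y) / 2 * Real.logb 2 (x + y) := by
  rcases le_total x y with h | h
  · rw [min_eq_left h]
    exact mul_logb_add_mul_logb_add_le hx h
  · rw [min_eq_right h, add_comm (x / 2 * _), add_comm x y]
    exact mul_logb_add_mul_logb_add_le hy h

/-- Splitting at an interior minimum `c`: a ball not centred at `c` does not contain `c`. -/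
theorem minBalls_subset {γ : Type*} [LinearOrder γ] {f : ℕ → γ} {lo hi c : ℕ}
    (hmin : ∀ k, lo < k → k < hi → f c ≤ f k) :
    minBalls f lo hi ⊆ minBalls f lo c ∪ minBalls f c hi ∪
      (Finset.Icc 1 (min (c - lo) (hi - c))).image fun r => (c, r) := by
  rintro ⟨a, r⟩ h
  obtain ⟨hr, hlo, hhi, hk⟩ := mem_minBalls.1 h
  simp only [Finset.mem_union, mem_minBalls, Finset.mem_image, Finset.mem_Icc, Prod.mk.injEq]
  have hca := hmin a (by omega) (by omega)
  rcases lt_trichotomy a c with hac | rfl | hac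
  · refine Or.inl (Or.inl ⟨hr, hlo, ?_, hk⟩)
    by_contra hcon
    exact hca.not_gt (hk c (by omega) (by omega) hac.ne')
  · exact Or.inr ⟨r, by omega, rfl, rfl⟩
  · refine Or.inl (Or.inr ⟨hr, ?_, hhi, hk⟩)
    by_contra hcon
    exact hca.not_gt (hk c (by omega) (by omega) hac.ne)

theorem card_minBalls_le {γ : Type*} [LinearOrder γ] (f : ℕ → γ) (lo hi : ℕ) (h : lo < hi) :
    ((minBalls f lo hi).card : ℝ) ≤
      ((hi - lo : ℕ) : ℝ) / 2 * Real.logb 2 ((hi - lo : ℕ) : ℝ) := by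
  induction hm : hi - lo using Nat.strong_induction_on generalizing lo hi with
  | _ m ih =>
  rcases Nat.lt_or_ge (lo + 1) hi with h2 | h2
  · obtain ⟨c, hc, hmin⟩ := Finset.exists_min_image (Finset.Ioo lo hi) f
      ⟨lo + 1, by simp [h2]⟩
    rw [Finset.mem_Ioo] at hc
    have hsub := minBalls_subset (f := f) (lo := lo) (hi := hi) (c := c)
      fun k hk hk' => hmin k (Finset.mem_Ioo.2 ⟨hk, hk'⟩)
    have h1 := ih (c - lo) (by omega) lo c hc.1 rfl
    have h3 := ih (hi - c) (by omega) c hi hc.2 rfl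
    have hcard : (minBalls f lo hi).card ≤ (minBalls f lo c).card + (minBalls f c hi).card +
        min (c - lo) (hi - c) := by
      refine (Finset.card_le_card hsub).trans ((Finset.card_union_le _ _).trans ?_)
      refine add_le_add (Finset.card_union_le _ _) (Finset.card_image_le.trans ?_)
      simp
    have hreal := mul_logb_add_mul_logb_add_min_le
      (x := ((c - lo : ℕ) : ℝ)) (y := ((hi - c : ℕ) : ℝ))
      (by exact_mod_cast Nat.sub_pos_of_lt hc.1) (by exact_mod_cast Nat.sub_pos_of_lt hc.2)
    have hadd : ((c - lo : ℕ) : ℝ) + ((hi - c : ℕ) : ℝ) = (m : ℝ) := by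
      rw [← Nat.cast_add]; congr 1; omega
    rw [hadd] at hreal
    have hcard' : ((minBalls f lo hi).card : ℝ) ≤ (minBalls f lo c).card +
        (minBalls f c hi).card + min ((c - lo : ℕ) : ℝ) ((hi - c : ℕ) : ℝ) := by
      exact_mod_cast hcard
    linarith
  · have he : minBalls f lo hi = ∅ := by
      refine Finset.eq_empty_of_forall_notMem ?_
      rintro ⟨a, r⟩ har
      obtain ⟨_, _, _, _⟩ := mem_minBalls.1 har
      omega
    have : m = 1 := by omega
    simp [he, this]

/-! ### Suffixes and least rotations -/

/-- The infinite word `W k, W (k + 1), …`, in the lexicographic order. -/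
def shiftWord {β : Type*} (W : ℕ → β) (k : ℕ) : Lex (ℕ → β) := toLex fun t => W (k + t)

theorem shiftWord_lt_iff {β : Type*} [LinearOrder β] {W : ℕ → β} {k l : ℕ} :
    shiftWord W k < shiftWord W l ↔
      ∃ t, (∀ x < t, W (k + x) = W (l + x)) ∧ W (k + t) < W (l + t) :=
  Iff.rfl

/-- In a word of least period `p`, some position in `[1, p]` starts a strictly least rotation. The
two bounds on the place `t` of the first difference say that the comparison with a rotation starting
at an earlier position is decided within one period, and that with one starting at a later position
`k < s + p` before the position `s + p`; the latter is the statement that the least rotation, a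
Lyndon word, has no border. -/
theorem exists_least_rotation {β : Type*} [LinearOrder β] {V : ℕ → β} {p : ℕ} (hp : 0 < p)
    (hV : Function.Periodic V p) (hmin : ∀ q, 0 < q → q < p → ¬ Function.Periodic V q) :
    ∃ s, 0 < s ∧ s ≤ p ∧
      (∀ k, 0 < k → k < s →
        ∃ t < p, (∀ x < t, V (s + x) = V (k + x)) ∧ V (s + t) < V (k + t)) ∧
      (∀ k, s < k → k < s + p →
        ∃ t, k + t < s + p ∧ (∀ x < t, V (s + x) = V (k + x)) ∧ V (s + t) < V (k + t)) := by
  obtain ⟨s, hs, hle⟩ := Finset.exists_min_image (Finset.Icc 1 p) (shiftWord V)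
    ⟨1, Finset.mem_Icc.2 ⟨le_rfl, hp⟩⟩
  rw [Finset.mem_Icc] at hs
  have hper : Function.Periodic (shiftWord V) p := fun k => by
    refine congrArg toLex (funext fun t => ?_)
    rw [add_right_comm]
    exact hV _
  have hle2 : ∀ k, k ∈ Finset.Icc 1 (2 * p) → shiftWord V s ≤ shiftWord V k := by
    intro k hk
    rw [Finset.mem_Icc] at hk
    by_cases hkp : k ≤ p
    · exact hle k (Finset.mem_Icc.2 ⟨hk.1, hkp⟩)
    · have := hper (k - p)
      rw [Nat.sub_add_cancel (by omega)] at this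
      rw [this]
      exact hle _ (Finset.mem_Icc.2 (by omega))
  have hne : ∀ k l, k < l → l < k + p → shiftWord V k ≠ shiftWord V l := by
    intro k l hkl hlp heq
    refine hmin (l - k) (by omega) (by omega) fun x => ?_
    -- every position is congruent modulo `p` to one beyond `k`
    have hx := congrFun (congrArg ofLex heq) (x + k * p - k)
    have hkp : k ≤ k * p := Nat.le_mul_of_pos_right _ hp
    have h1 : V (x + k * p) = V x := hV.nat_mul k x
    have h2 : V (x + (l - k) + k * p) = V (x + (l - k)) := hV.nat_mul k _
    rw [← h1, ← h2]
    simp only [shiftWord, ofLex_toLex] at hx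
    rw [show k + (x + k * p - k) = x + k * p by omega,
      show l + (x + k * p - k) = x + (l - k) + k * p by omega] at hx
    exact hx.symm
  refine ⟨s, hs.1, hs.2, fun k hk hks => ?_, fun k hsk hkp => ?_⟩
  · obtain ⟨t, ht, hlt⟩ := shiftWord_lt_iff.1 <|
      (hle2 k (Finset.mem_Icc.2 (by omega))).lt_of_ne (hne k s hks (by omega)).symm
    refine ⟨t, ?_, ht, hlt⟩
    by_contra! hpt
    have h1 := hV (s + (t - p))
    have h2 := hV (k + (t - p))
    rw [show s + (t - p) + p = s + t by omega] at h1
    rw [show k + (t - p) + p = k + t by omega] at h2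
    rw [h1, h2, ht (t - p) (by omega)] at hlt
    exact lt_irrefl _ hlt
  · obtain ⟨t, ht, hlt⟩ := shiftWord_lt_iff.1 <|
      (hle2 k (Finset.mem_Icc.2 (by omega))).lt_of_ne (hne s k hsk hkp)
    refine ⟨t, ?_, ht, hlt⟩
    by_contra! hpt
    -- removing the common border `[k, s + p)` from both words leaves a rotation smaller than
    -- the one at `s + p`, which is the least one
    refine (hle2 (s + (s + p - k)) (Finset.mem_Icc.2 (by omega))).not_gt ?_
    rw [← hper s]
    refine shiftWord_lt_iff.2 ⟨t - (s + p - k), fun x hx => ?_, ?_⟩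
    · have := ht (s + p - k + x) (by omega)
      rwa [← add_assoc, ← add_assoc, show k + (s + p - k) = s + p by omega] at this
    · rwa [show s + (s + p - k) + (t - (s + p - k)) = s + t by omega,
        show s + p + (t - (s + p - k)) = k + t by omega]

/-- The charge of a square. Let the infinite word `W` have period `p` on `[i, j)`, where
`i + 2 * p ≤ j`, let it continue with a smaller letter than that period demands, and let `p` be the
least period of the repetition of `W i, …, W (i + p - 1)`. Then some `a ∈ (i, i + p]` has a smaller
suffix than all other positions in `(i, a + p)`, but a larger one than `a + p`. -/
theorem exists_suffix_min {β : Type*} [LinearOrder β] {W : ℕ → β} {i p j : ℕ} (hp : 0 < p)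
    (hmin : ∀ q, 0 < q → q < p → ¬ Function.Periodic (fun k => W (i + k % p)) q)
    (hj : i + 2 * p ≤ j) (hW : ∀ k, i ≤ k → k + p < j → W (k + p) = W k)
    (hlt : W j < W (j - p)) :
    ∃ a, i < a ∧ a ≤ i + p ∧
      (∀ k, i < k → k < a + p → k ≠ a → shiftWord W a < shiftWord W k) ∧
      shiftWord W (a + p) < shiftWord W a := by
  have hV : Function.Periodic (fun k => W (i + k % p)) p := fun k => by simp
  obtain ⟨s, hs0, hsp, hl, hr⟩ := exists_least_rotation hp hV hmin
  have hval : ∀ x < 2 * p, W (i + x % p) = W (i + x) := by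
    intro x hx
    rcases Nat.lt_or_ge x p with h | h
    · rw [Nat.mod_eq_of_lt h]
    · rw [Nat.mod_eq_sub_mod h, Nat.mod_eq_of_lt (by omega), ← hW _ (by omega) (by omega)]
      congr 1
      omega
  have transfer : ∀ k t, k + t < 2 * p → s + t < 2 * p →
      (∀ x < t, W (i + (s + x) % p) = W (i + (k + x) % p)) →
      W (i + (s + t) % p) < W (i + (k + t) % p) → shiftWord W (i + s) < shiftWord W (i + k) := by
    intro k t hk hs h h'
    refine shiftWord_lt_iff.2 ⟨t, fun x hx => ?_, ?_⟩
    · have := h x hx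
      rw [hval _ (by omega), hval _ (by omega)] at this
      rwa [add_assoc, add_assoc]
    · rw [hval _ hs, hval _ hk] at h'
      rwa [add_assoc, add_assoc]
  refine ⟨i + s, by omega, by omega, fun k hik hkp hne => ?_, ?_⟩
  · obtain ⟨k, rfl⟩ := Nat.exists_eq_add_of_lt hik
    rw [add_assoc] at hik hkp hne ⊢
    rcases Nat.lt_or_ge (k + 1) s with h | h
    · obtain ⟨t, ht, h1, h2⟩ := hl (k + 1) (by omega) h
      exact transfer _ t (by omega) (by omega) h1 h2
    · obtain ⟨t, ht, h1, h2⟩ := hr (k + 1) (by omega) (by omega)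
      exact transfer _ t (by omega) (by omega) h1 h2
  · refine shiftWord_lt_iff.2 ⟨j - (i + s + p), fun x hx => ?_, ?_⟩
    · rw [add_right_comm]
      exact hW _ (by omega) (by omega)
    · rwa [show i + s + p + (j - (i + s + p)) = j by omega,
        show i + s + (j - (i + s + p)) = j - p by omega]

/-! ### Primitive strings -/

theorem power_succ {α : Type*} (x : List α) (m : ℕ) : power x (m + 1) = x ++ power x m := by
  simp [power, List.replicate_succ]

theorem eq_power_of_period {α : Type*} {g : ℕ} (m : ℕ) (u : List α) (hu : u.length = m * g)
    (h : ∀ k, k + g < u.length → u[k + g]? = u[k]?) : u = power (u.take g) m := by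
  induction m generalizing u with
  | zero =>
    rw [zero_mul, List.length_eq_zero_iff] at hu
    simp [hu, power]
  | succ m ih =>
    rw [Nat.succ_mul] at hu
    have hd := ih (u.drop g) (by simp [hu]) fun k hk => by
      rw [List.length_drop] at hk
      rw [List.getElem?_drop, List.getElem?_drop, add_comm g, add_comm g,
        h (k + g) (by omega)]
    rw [power_succ]
    rcases m with _ | m
    · have : u.length ≤ g := by omega
      simp [power, List.take_of_length_le this]
    · have ht : (u.drop g).take g = u.take g := by
        refine List.ext_getElem? fun k => ?_
        rw [Nat.succ_mul] at hu
        by_cases hk : k < g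
        · rw [List.getElem?_take_of_lt hk, List.getElem?_take_of_lt hk, List.getElem?_drop,
            add_comm, h k (by omega)]
        · rw [List.getElem?_eq_none (by simp; omega), List.getElem?_eq_none (by simp; omega)]
      rw [ht] at hd
      conv_lhs => rw [← List.take_append_drop g u, hd]

theorem IsPrimitive.length_pos {α : Type*} {u : List α} (hu : IsPrimitive u) : 0 < u.length := by
  rw [List.length_pos_iff]
  rintro rfl
  exact hu ⟨[], 2, le_rfl, by simp [power]⟩

/-- The length of a primitive string is the least period of its infinite repetition: the least
period divides every period, hence the length. -/
theorem IsPrimitive.not_periodic {α : Type*} {u : List α} (hu : IsPrimitive u) {q : ℕ} (hq : 0 < q)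
    (hqu : q < u.length) : ¬ Function.Periodic (fun k => u[k % u.length]?) q := by
  classical
  intro hper
  have hex : ∃ q, 0 < q ∧ Function.Periodic (fun k => u[k % u.length]?) q := ⟨q, hq, hper⟩
  obtain ⟨hg, hgper⟩ := Nat.find_spec hex
  have hgq : Nat.find hex ≤ q := Nat.find_min' hex ⟨hq, hper⟩
  have hleast := fun m (hm : m < Nat.find hex) => Nat.find_min hex hm
  generalize Nat.find hex = g at hg hgper hgq hleast
  have hdvd : g ∣ u.length := by
    by_contra hnd
    refine hleast _ (Nat.mod_lt u.length hg)
      ⟨Nat.pos_of_ne_zero fun h => hnd (Nat.dvd_of_mod_eq_zero h), fun k => ?_⟩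
    have h := hgper.nat_mul (u.length / g) (k + u.length % g)
    simp only [Nat.cast_id] at h ⊢
    rw [← h, add_assoc, mul_comm, Nat.mod_add_div, Nat.add_mod_right]
  obtain ⟨m, hm⟩ := hdvd
  refine hu ⟨u.take g, m, ?_, eq_power_of_period m u (by rw [hm, mul_comm]) fun k hk => ?_⟩
  · by_contra hm2
    have : m = 0 ∨ m = 1 := by omega
    rcases this with rfl | rfl <;> omega
  · have := hgper k
    simp only at this
    rwa [Nat.mod_eq_of_lt hk, Nat.mod_eq_of_lt (by omega)] at this

/-! ### Charging squares to balls -/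

/-- The letters of `w`, ordered through `e`, followed by the least letter `⊥` forever. -/
def extend {α γ : Type*} (e : α → γ) (w : List α) (k : ℕ) : WithBot γ := (w[k]?).map e

theorem extend_eq_iff {α γ : Type*} {e : α → γ} (he : Function.Injective e) {w : List α}
    {k l : ℕ} : extend e w k = extend e w l ↔ w[k]? = w[l]? :=
  (Option.map_injective he).eq_iff

/-- The square that starts at `a - r` and whose period is the distance from `a` to the next position
with a smaller value of `f`. -/
noncomputable def squareOfBall {α γ : Type*} [LinearOrder γ] (w : List α) (f : ℕ → γ) (x : ℕ × ℕ) :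
    ℕ × List α :=
  (x.1 - x.2, (w.drop (x.1 - x.2)).take (2 * sInf {q | 0 < q ∧ f (x.1 + q) < f x.1}))

theorem mem_image_squareOfBall {α γ : Type*} [LinearOrder γ] {e : α → γ}
    (he : Function.Injective e) {w : List α} {i j : ℕ} {u : List α} (hu : IsPrimitive u)
    (hocc : OccursAt (u ++ u) w i) (hj : i + 2 * u.length ≤ j)
    (hW : ∀ k, i ≤ k → k + u.length < j → w[k + u.length]? = w[k]?)
    (hlt : extend e w j < extend e w (j - u.length)) :
    (i, u ++ u) ∈ squareOfBall w (shiftWord (extend e w)) ''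
      (minBalls (shiftWord (extend e w)) 0 w.length : Set (ℕ × ℕ)) := by
  obtain ⟨x, y, hw, hx⟩ := hocc
  have hlen : i + 2 * u.length ≤ w.length := by simp [hw, hx]; omega
  have hletter : ∀ k < u.length, w[i + k]? = u[k]? := by
    intro k hk
    rw [hw, ← hx, List.append_assoc, List.append_assoc, List.getElem?_append_right (by omega),
      List.getElem?_append_left (by omega)]
    congr 1
    omega
  obtain ⟨a, hia, hap, hmin, hnext⟩ := exists_suffix_min (W := extend e w) (i := i) (j := j)
    hu.length_pos (fun q hq hqu hper => hu.not_periodic hq hqu fun k => by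
      have := hper k
      simp only [extend_eq_iff he] at this
      rwa [hletter _ (Nat.mod_lt _ hu.length_pos), hletter _ (Nat.mod_lt _ hu.length_pos)] at this)
    hj (fun k hk hk' => (extend_eq_iff he).2 (hW k hk hk')) hlt
  refine ⟨(a, a - i), ?_, ?_⟩
  · rw [Finset.mem_coe, mem_minBalls]
    exact ⟨by omega, by omega, by omega, fun k h1 h2 h3 => hmin k (by omega) (by omega) h3⟩
  · have hleast : IsLeast {q | 0 < q ∧ shiftWord (extend e w) (a + q) < shiftWord (extend e w) a}
        u.length := by
      refine ⟨⟨hu.length_pos, hnext⟩, fun q hq => ?_⟩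
      by_contra! hqu
      exact (hmin (a + q) (by omega) (by omega) (by have := hq.1; omega)).not_gt hq.2
    have hai : a - (a - i) = i := by omega
    have hball : squareOfBall w (shiftWord (extend e w)) (a, a - i) =
        (a - (a - i), (w.drop (a - (a - i))).take (2 * u.length)) :=
      congrArg (fun q => (a - (a - i), (w.drop (a - (a - i))).take (2 * q))) hleast.csInf_eq
    rw [hball, hai, Prod.mk.injEq]
    refine ⟨rfl, ?_⟩
    rw [hw, ← hx, List.append_assoc, List.drop_left, List.take_left' (by simp; omega)]

/-- The right end of the maximal repetition that contains a given square. -/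
theorem exists_period_end {α : Type*} {w u : List α} {i : ℕ} (hu : 0 < u.length)
    (hocc : OccursAt (u ++ u) w i) :
    ∃ j, i + 2 * u.length ≤ j ∧ (∀ k, i ≤ k → k + u.length < j → w[k + u.length]? = w[k]?) ∧
      w[j]? ≠ w[j - u.length]? := by
  classical
  obtain ⟨x, y, hw, hx⟩ := hocc
  have hlen : i + 2 * u.length ≤ w.length := by simp [hw, hx]; omega
  have hsq : ∀ k < u.length, w[i + k + u.length]? = w[i + k]? := by
    intro k hk
    have h1 : w[i + k]? = u[k]? := by
      rw [hw, ← hx, List.append_assoc, List.append_assoc, List.getElem?_append_right (by omega),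
        List.getElem?_append_left (by omega)]
      congr 1
      omega
    have h2 : w[i + k + u.length]? = u[k]? := by
      rw [hw, ← hx, List.append_assoc, List.append_assoc, List.getElem?_append_right (by omega),
        List.getElem?_append_right (by omega), List.getElem?_append_left (by omega)]
      congr 1
      omega
    rw [h1, h2]
  have hex : ∃ k, i ≤ k ∧ w[k + u.length]? ≠ w[k]? := by
    refine ⟨w.length - 1, by omega, ?_⟩
    rw [List.getElem?_eq_none (by omega), List.getElem?_eq_getElem (by omega)]
    simp
  obtain ⟨hik, hne⟩ := Nat.find_spec hex
  have hfirst := fun m (hm : m < Nat.find hex) => Nat.find_min hex hm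
  generalize Nat.find hex = k at hik hne hfirst
  refine ⟨k + u.length, ?_, fun l hl hlk => ?_, by simpa using hne⟩
  · by_contra hcon
    have := hsq (k - i) (by omega)
    rw [show i + (k - i) = k by omega] at this
    exact hne this
  · by_contra hcon
    exact hfirst l (by omega) ⟨hl, hcon⟩

/-- The end of a maximal repetition is a descent in the given order or in the opposite one: the end
of the string is a descent in both. -/
theorem extend_lt_or_extend_toDual_lt {α : Type*} [LinearOrder α] {w : List α} {k l : ℕ}
    (hkl : k ≤ l) (hne : w[l]? ≠ w[k]?) :
    extend id w l < extend id w k ∨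
      extend OrderDual.toDual w l < extend OrderDual.toDual w k := by
  have hk : k < w.length := by
    by_contra hcon
    exact hne (by rw [List.getElem?_eq_none (by omega), List.getElem?_eq_none (by omega)])
  unfold extend
  rw [List.getElem?_eq_getElem hk] at hne ⊢
  rcases Nat.lt_or_ge l w.length with hl | hl
  · rw [List.getElem?_eq_getElem hl] at hne ⊢
    rcases lt_or_gt_of_ne fun h : w[l] = w[k] => hne (congrArg some h) with h | h
    · exact Or.inl (WithBot.coe_lt_coe.2 h)
    · exact Or.inr (WithBot.coe_lt_coe.2 (OrderDual.toDual_lt_toDual.2 h))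
  · rw [List.getElem?_eq_none hl]
    exact Or.inl (WithBot.bot_lt_coe _)

theorem squareOccurrences_subset {α : Type*} [LinearOrder α] (w : List α) :
    squareOccurrences w ⊆
      squareOfBall w (shiftWord (extend id w)) ''
        (minBalls (shiftWord (extend id w)) 0 w.length : Set (ℕ × ℕ)) ∪
      squareOfBall w (shiftWord (extend OrderDual.toDual w)) ''
        (minBalls (shiftWord (extend OrderDual.toDual w)) 0 w.length : Set (ℕ × ℕ)) := by
  rintro ⟨i, _⟩ ⟨⟨u, hu, rfl⟩, hocc⟩
  obtain ⟨j, hj, hW, hne⟩ := exists_period_end hu.length_pos hocc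
  rcases extend_lt_or_extend_toDual_lt (Nat.sub_le _ _) hne with h | h
  · exact Or.inl (mem_image_squareOfBall Function.injective_id hu hocc hj hW h)
  · exact Or.inr (mem_image_squareOfBall OrderDual.toDual.injective hu hocc hj hW h)

theorem numSquares_le {α : Type*} (w : List α) (hw : 0 < w.length) :
    (numSquares w : ℝ) ≤ w.length * Real.logb 2 w.length := by
  classical
  let _ : LinearOrder α := linearOrderOfSTO WellOrderingRel
  have h1 := card_minBalls_le (shiftWord (extend (id : α → α) w)) 0 w.length hw
  have h2 := card_minBalls_le (shiftWord (extend (OrderDual.toDual : α → αᵒᵈ) w)) 0 w.length hw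
  have h3 : numSquares w ≤ (minBalls (shiftWord (extend (id : α → α) w)) 0 w.length).card +
      (minBalls (shiftWord (extend (OrderDual.toDual : α → αᵒᵈ) w)) 0 w.length).card := by
    refine (Set.ncard_le_ncard (squareOccurrences_subset w)
      (((Finset.finite_toSet _).image _).union ((Finset.finite_toSet _).image _))).trans ?_
    refine (Set.ncard_union_le _ _).trans (add_le_add ?_ ?_) <;>
    · refine (Set.ncard_image_le (Finset.finite_toSet _)).trans ?_
      rw [Set.ncard_coe_finset]
  have h3' : (numSquares w : ℝ) ≤
      (minBalls (shiftWord (extend (id : α → α) w)) 0 w.length).card +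
      (minBalls (shiftWord (extend (OrderDual.toDual : α → αᵒᵈ) w)) 0 w.length).card := by
    exact_mod_cast h3
  rw [Nat.sub_zero] at h1 h2
  linarith

end Squares

/-- The first conjunct records that the maximum defining `psq α n` exists and is attained. -/
theorem theorem1 (α : Type*) [Nonempty α] (n : ℕ) (hn : 1 ≤ n) :
    IsGreatest (Squares.squareCounts α n) (Squares.psq α n) ∧
      (Squares.psq α n : ℝ) ≤ (n : ℝ) * Real.logb 2 (n : ℝ) := by
  have hle : ∀ m ∈ Squares.squareCounts α n, (m : ℝ) ≤ (n : ℝ) * Real.logb 2 (n : ℝ) := by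
    rintro m ⟨w, rfl, rfl⟩
    exact Squares.numSquares_le w hn
  have hbdd : BddAbove (Squares.squareCounts α n) :=
    ⟨⌊(n : ℝ) * Real.logb 2 (n : ℝ)⌋₊, fun m hm => Nat.le_floor (hle m hm)⟩
  have hne : (Squares.squareCounts α n).Nonempty :=
    ⟨_, List.replicate n (Classical.arbitrary α), List.length_replicate, rfl⟩
  have hmem : Squares.psq α n ∈ Squares.squareCounts α n := Nat.sSup_mem hne hbdd
  exact ⟨⟨hmem, fun m hm => le_csSup hbdd hm⟩, hle _ hmem⟩
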